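/- Let $d$ and $n$ be integers with $d>10$ such that $d$-regular simple graphs on $n$ labelled vertices exist, and let $G$ be chosen uniformly at random among them. Two-sample voting on $G$ is the following process. Every vertex holds one of two opinions $A$ and $B$. In each step, simultaneously and independently, every vertex queries two uniformly random neighbours (sampled with or without replacement); if the two queried vertices hold the same opinion, the vertex adopts that opinion, and otherwise it keeps its own. An adversary who knows $G$ chooses the initial distribution of the opinions and, at the beginning of each step, knowing the course of the process so far, may rearrange the opinions arbitrarily among the vertices without changing the number of vertices with each opinion (doing nothing is allowed, so plain voting from an arbitrary initial distribution is included). Theorem. There are absolute constants $c>0$ and $C>0$ (independent of $d$ and $n$) such that, provided that initially at most $cn$ vertices hold the opinion $B$, with high probability all vertices hold the opinion $A$ after at most $C\log n$ steps. That is: for every $\delta>0$ there is an $N$ such that for all $n\ge N$, all $d>10$ for which $d$-regular graphs on $n$ vertices exist (so $d$ may depend on $n$), either way of sampling, and every such adversary, this happens with probability at least $1-\delta$, where the probability is over both the choice of $G$ and the voting process. -/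

import Mathlib

/-- The `d`-regular simple graphs on the vertex set `Fin n`. -/
abbrev RegularGraph (n d : ℕ) : Type :=
  open Classical in {G : SimpleGraph (Fin n) // G.IsRegularOfDegree d}

/-- The random `d`-regular graph on `n` vertices: uniform among all `d`-regular graphs on `Fin n`
(defined whenever there is at least one such graph). -/
noncomputable def randomRegularGraph (n d : ℕ) [Nonempty (RegularGraph n d)] :
    PMF (RegularGraph n d) :=
  letI : Fintype (RegularGraph n d) := Fintype.ofFinite _
  PMF.uniformOfFintype (RegularGraph n d)

/-- The two ways in which a vertex may sample two of its neighbours. -/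
inductive Sampling
  | withReplacement
  | withoutReplacement

/-- The possible samples of a vertex `v`: the ordered pairs of neighbours of `v`, and the two
neighbours are different if the sampling is without replacement. -/
noncomputable def neighbourPairs {V : Type*} [Fintype V] (m : Sampling) (G : SimpleGraph V)
    (v : V) : Finset (V × V) :=
  open Classical in
  Finset.univ.filter fun p : V × V =>
    G.Adj v p.1 ∧ G.Adj v p.2 ∧ (m = Sampling.withoutReplacement → p.1 ≠ p.2)

/-- As `neighbourPairs`, made total: a vertex that has too few neighbours for a sample queries
itself (and so keeps its opinion). This does not happen in regular graphs of degree at least 2. -/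
noncomputable def samples {V : Type*} [Fintype V] (m : Sampling) (G : SimpleGraph V)
    (v : V) : Finset (V × V) :=
  open Classical in
  if (neighbourPairs m G v).Nonempty then neighbourPairs m G v else {(v, v)}

theorem samples_nonempty {V : Type*} [Fintype V] (m : Sampling) (G : SimpleGraph V) (v : V) :
    (samples m G v).Nonempty := by
  unfold samples
  split_ifs with h
  · exact h
  · exact Finset.singleton_nonempty _

/-- The random choices in one voting step: every vertex `v` picks a uniformly random element of
`samples m G v`, independently of the other vertices (the uniform law on the product set is the
product of the uniform laws). -/
noncomputable def roundLaw {V : Type*} [Fintype V] [DecidableEq V] (m : Sampling)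
    (G : SimpleGraph V) : PMF (V → V × V) :=
  PMF.uniformOfFinset (Fintype.piFinset (samples m G))
    (Fintype.piFinset_nonempty.mpr (samples_nonempty m G))

/-- The two-sample rule. `B` is the set of vertices with opinion `B` (all other vertices have
opinion `A`) and `ω v` is the pair of vertices queried by `v`. If the two queried vertices have the
same opinion then `v` adopts it, otherwise `v` keeps its own opinion. The result is the new set of
vertices with opinion `B`. -/
def vote {V : Type*} [Fintype V] [DecidableEq V] (B : Finset V) (ω : V → V × V) : Finset V :=
  Finset.univ.filter fun v =>
    if ((ω v).1 ∈ B ↔ (ω v).2 ∈ B) then (ω v).1 ∈ B else v ∈ B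

/-- An adversary: at the beginning of each voting step it sees the current set `B` and the list of
all the earlier ones (latest first), and rearranges the opinions without changing the number of
vertices with each opinion. -/
structure Adversary (V : Type*) where
  move : List (Finset V) → Finset V → Finset V
  card_move : ∀ past B, (move past B).card = B.card

/-- The adversary that never does anything: with it the process below is plain two-sample voting. -/
def Adversary.idle (V : Type*) : Adversary V where
  move _ B := B
  card_move _ _ := rfl

/-- The law of two-sample voting after `t` steps, started with the set `B₀` of vertices with
opinion `B`: the current set of vertices with opinion `B`, and the list of all the earlier ones. In
each step the adversary rearranges the opinions, and then all vertices vote simultaneously. -/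
noncomputable def votingHistory {V : Type*} [Fintype V] [DecidableEq V] (m : Sampling)
    (G : SimpleGraph V) (adv : Adversary V) (B₀ : Finset V) :
    ℕ → PMF (Finset V × List (Finset V))
  | 0 => PMF.pure (B₀, [])
  | t + 1 => (votingHistory m G adv B₀ t).bind fun s =>
      (roundLaw m G).map fun ω => (vote (adv.move s.2 s.1) ω, s.1 :: s.2)

/-- The law of the set of vertices with opinion `B` after `t` voting steps. Once this set is empty
all vertices have opinion `A` and this does not change any more. -/
noncomputable def votersB {V : Type*} [Fintype V] [DecidableEq V] (m : Sampling)
    (G : SimpleGraph V) (adv : Adversary V) (B₀ : Finset V) (t : ℕ) : PMF (Finset V) :=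
  (votingHistory m G adv B₀ t).map Prod.fst

/-! A random regular graph is locally sparse, and on a locally sparse regular graph the size of a
small set `B` contracts in expectation wherever its members are placed. Every estimate depends on
`B` only through its size, so an adversary that preserves the size gains nothing.

Sparsity: an edge switching argument (`card_regularContaining_mul_le`) bounds the probability that
`m` given edges are all present by `(2d/n)^m`. A union bound over sets `U` of `k ≤ n/1250` vertices
and over `⌈2dk/11⌉` edges inside `U` gives `card_not_sparse_le`, with failure probability `O(1/n)`.
For `d ≥ 11` each such `U` would contain at least `2k` edges, enough to beat the number of choices
of `U`.

Contraction: a vertex with `b` of its `d` neighbours in `B` ends up in `B` with probability at most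
`(b/d)^2` if it starts outside and at most `2b/d` if it starts inside. Few vertices outside `B` have
many neighbours in `B`; sparsity of `B` together with those vertices bounds the sum of these
probabilities by `10/11 * #B` (`Sparse.sum_adoptProb_le`).

Conclusion: a Chernoff bound keeps the size below `n/10000` throughout, except with probability
exponentially small in `n` per step. Hence the expected size decays geometrically up to a negligible
error, and Markov's inequality after `22 log n` steps shows that `B` is empty. -/

namespace TwoSampleVoting

open Finset

/-! ### Edge switchings and the probability of containing given edges -/

section Switching

variable {V : Type*}

/-- Replace the edges `uv`, `xy` by `ux`, `vy`. -/
def edgeSwitch (G : SimpleGraph V) (u v x y : V) : SimpleGraph V :=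
  SimpleGraph.fromEdgeSet ((G.edgeSet \ {s(u, v), s(x, y)}) ∪ {s(u, x), s(v, y)})

theorem edgeSwitch_adj {G : SimpleGraph V} {u v x y a b : V} :
    (edgeSwitch G u v x y).Adj a b ↔
      ((G.Adj a b ∧ s(a, b) ≠ s(u, v) ∧ s(a, b) ≠ s(x, y)) ∨ s(a, b) = s(u, x) ∨
        s(a, b) = s(v, y)) ∧ a ≠ b := by
  simp only [edgeSwitch, SimpleGraph.fromEdgeSet_adj, Set.mem_union, Set.mem_sdiff,
    SimpleGraph.mem_edgeSet, Set.mem_insert_iff, Set.mem_singleton_iff, not_or]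

theorem edgeSwitch_swap (G : SimpleGraph V) (u v x y : V) :
    edgeSwitch G u v x y = edgeSwitch G v u y x := by
  ext a b
  simp only [edgeSwitch_adj, Sym2.eq_swap (a := v) (b := u), Sym2.eq_swap (a := y) (b := x)]
  tauto

theorem edgeSwitch_comm (G : SimpleGraph V) (u v x y : V) :
    edgeSwitch G u v x y = edgeSwitch G x y u v := by
  ext a b
  simp only [edgeSwitch_adj, Sym2.eq_swap (a := x) (b := u), Sym2.eq_swap (a := y) (b := v)]
  tauto

/-- The conditions under which replacing `uv`, `xy` by `ux`, `vy` preserves all degrees. -/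
structure Switchable (G : SimpleGraph V) (u v x y : V) : Prop where
  adj₁ : G.Adj u v
  adj₂ : G.Adj x y
  ne₁ : u ≠ x
  ne₂ : v ≠ y
  not_adj₁ : ¬ G.Adj u x
  not_adj₂ : ¬ G.Adj v y

theorem Switchable.swap {G : SimpleGraph V} {u v x y : V} (h : Switchable G u v x y) :
    Switchable G v u y x :=
  ⟨h.adj₁.symm, h.adj₂.symm, h.ne₂, h.ne₁, h.not_adj₂, h.not_adj₁⟩

theorem Switchable.comm {G : SimpleGraph V} {u v x y : V} (h : Switchable G u v x y) :
    Switchable G x y u v :=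
  ⟨h.adj₂, h.adj₁, h.ne₁.symm, h.ne₂.symm, fun e => h.not_adj₁ e.symm, fun e => h.not_adj₂ e.symm⟩

theorem Switchable.edgeSwitch_edgeSwitch {G : SimpleGraph V} {u v x y : V}
    (h : Switchable G u v x y) : edgeSwitch (edgeSwitch G u v x y) u x v y = G := by
  obtain ⟨h1, h2, h3, h4, h5, h6⟩ := h
  ext a b
  have e1 : s(a, b) = s(u, v) → G.Adj a b := fun e => by
    rw [← SimpleGraph.mem_edgeSet, e]; exact h1
  have e2 : s(a, b) = s(x, y) → G.Adj a b := fun e => by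
    rw [← SimpleGraph.mem_edgeSet, e]; exact h2
  have e3 : s(a, b) = s(u, x) → ¬ G.Adj a b := fun e => by
    rw [← SimpleGraph.mem_edgeSet, e]; exact h5
  have e4 : s(a, b) = s(v, y) → ¬ G.Adj a b := fun e => by
    rw [← SimpleGraph.mem_edgeSet, e]; exact h6
  have := G.ne_of_adj (a := a) (b := b)
  simp only [edgeSwitch_adj]
  tauto

variable [Fintype V]

open Classical in
/-- The neighbours of a vertex. -/
noncomputable def nbr (G : SimpleGraph V) (v : V) : Finset V := univ.filter (G.Adj v)

@[simp] theorem mem_nbr {G : SimpleGraph V} {v w : V} : w ∈ nbr G v ↔ G.Adj v w := by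
  simp [nbr]

variable [DecidableEq V]

theorem Switchable.card_nbr_left {G : SimpleGraph V} {u v x y : V} (h : Switchable G u v x y) :
    #(nbr (edgeSwitch G u v x y) u) = #(nbr G u) := by
  obtain ⟨h1, h2, h3, h4, h5, h6⟩ := h
  have huv := h1.ne
  have hxy := h2.ne
  have huy : u ≠ y := by rintro rfl; exact h6 h1.symm
  have : nbr (edgeSwitch G u v x y) u = insert x ((nbr G u).erase v) := by
    ext b
    simp only [mem_nbr, edgeSwitch_adj, mem_insert, mem_erase, Sym2.eq_iff]
    have := G.ne_of_adj (a := u) (b := b)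
    grind
  rw [this, card_insert_of_notMem (by simp [h5]), card_erase_add_one (by simpa using h1)]

theorem Switchable.card_nbr {G : SimpleGraph V} {u v x y : V} (h : Switchable G u v x y) (a : V) :
    #(nbr (edgeSwitch G u v x y) a) = #(nbr G a) := by
  by_cases ha : a = u
  · subst ha; exact h.card_nbr_left
  by_cases hb : a = v
  · subst hb; rw [edgeSwitch_swap]; exact h.swap.card_nbr_left
  by_cases hc : a = x
  · subst hc; rw [edgeSwitch_comm]; exact h.comm.card_nbr_left
  by_cases hd : a = y
  · subst hd; rw [edgeSwitch_comm, edgeSwitch_swap]; exact h.comm.swap.card_nbr_left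
  congr 1
  ext b
  simp only [mem_nbr, edgeSwitch_adj, Sym2.eq_iff]
  have := G.ne_of_adj (a := a) (b := b)
  grind

open Classical in
/-- The `d`-regular graphs on `V` that contain all edges in `F`. -/
noncomputable def regularContaining (d : ℕ) (F : Finset (Sym2 V)) : Finset (SimpleGraph V) :=
  univ.filter fun G => (∀ v, #(nbr G v) = d) ∧ ∀ e ∈ F, e ∈ G.edgeSet

theorem mem_regularContaining {d : ℕ} {F : Finset (Sym2 V)} {G : SimpleGraph V} :
    G ∈ regularContaining d F ↔ (∀ v, #(nbr G v) = d) ∧ ∀ e ∈ F, e ∈ G.edgeSet := by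
  simp [regularContaining]

open Classical in
/-- The pairs `(x, y)` for which the edges `uv`, `xy` may be switched without using `F`. -/
noncomputable def switches (G : SimpleGraph V) (F : Finset (Sym2 V)) (u v : V) : Finset (V × V) :=
  univ.filter fun p => Switchable G u v p.1 p.2 ∧ s(p.1, p.2) ∉ F

theorem card_filter_sym2_le (F : Finset (Sym2 V)) :
    #(univ.filter fun p : V × V => s(p.1, p.2) ∈ F) ≤ 2 * #F := by
  refine card_le_mul_card_image_of_maps_to (f := fun p : V × V => s(p.1, p.2))
    (t := F) (fun p hp => (mem_filter.1 hp).2) 2 fun e _ => ?_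
  induction e with
  | _ a b =>
    refine (card_le_card (t := {(a, b), (b, a)}) ?_).trans card_le_two
    rintro ⟨p, q⟩ hp
    simp only [mem_filter, Sym2.eq_iff] at hp
    simp only [mem_insert, mem_singleton, Prod.mk.injEq]
    exact hp.2

theorem card_adj_pairs {V : Type*} [Fintype V] {G : SimpleGraph V} {d : ℕ}
    (hG : ∀ v, #(nbr G v) = d) (S : Finset V) :
    #(S.sigma fun v => nbr G v) = #S * d := by
  simp [card_sigma, hG]

/-- Of the `n * d` ordered adjacent pairs `(x, y)`, a pair fails only if its edge lies in `F`, or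
`x` is `u` or a neighbour of `u`, or `y` is `v` or a neighbour of `v`. The last two cases exclude at
most `(d + 1) * d` pairs each. -/
theorem le_card_switches {G : SimpleGraph V} {d : ℕ} (hG : ∀ v, #(nbr G v) = d)
    (F : Finset (Sym2 V)) {u v : V} (huv : G.Adj u v) :
    Fintype.card V * d ≤ #(switches G F u v) + 2 * #F + 2 * ((d + 1) * d) := by
  have key : (univ : Finset V).sigma (fun v => nbr G v) ⊆
      ((switches G F u v).image fun p => (⟨p.1, p.2⟩ : Σ _ : V, V)) ∪
      (((univ.filter fun p : V × V => s(p.1, p.2) ∈ F).image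
        fun p => (⟨p.1, p.2⟩ : Σ _ : V, V)) ∪
      (((insert u (nbr G u)).sigma fun v => nbr G v) ∪
      (((insert v (nbr G v)).sigma fun v => nbr G v).image
        fun p => (⟨p.2, p.1⟩ : Σ _ : V, V)))) := by
    rintro ⟨x, y⟩ hxy
    simp only [mem_sigma, mem_univ, mem_nbr, true_and] at hxy
    simp only [mem_union, mem_image, mem_sigma, mem_insert, mem_nbr, mem_filter, mem_univ,
      true_and, Prod.exists, Sigma.exists, Sigma.mk.injEq, heq_eq_eq, switches]
    by_contra! hcon
    obtain ⟨c1, c2, c3, c4⟩ := hcon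
    by_cases hF : s(x, y) ∈ F
    · exact c2 x y hF rfl rfl
    refine c1 x y ⟨⟨huv, hxy, ?_, ?_, ?_, ?_⟩, hF⟩ rfl rfl
    · rintro rfl; exact c3 (Or.inl rfl) hxy
    · rintro rfl; exact c4 v x ⟨Or.inl rfl, hxy.symm⟩ rfl rfl
    · intro h; exact c3 (Or.inr h) hxy
    · intro h; exact c4 y x ⟨Or.inr h, hxy.symm⟩ rfl rfl
  have hins : ∀ w, #(insert w (nbr G w)) ≤ d + 1 := fun w =>
    (card_insert_le _ _).trans (by rw [hG])
  have h1 := card_le_card key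
  rw [card_adj_pairs hG, card_univ] at h1
  have h2 := (card_union_le _ _).trans (Nat.add_le_add_left ((card_union_le _ _).trans
    (Nat.add_le_add_left (card_union_le _ _) _)) _) |> h1.trans
  have h3 : #((switches G F u v).image fun p => (⟨p.1, p.2⟩ : Σ _ : V, V)) ≤ _ := card_image_le
  have h4 : #((univ.filter fun p : V × V => s(p.1, p.2) ∈ F).image
        fun p => (⟨p.1, p.2⟩ : Σ _ : V, V)) ≤ _ := card_image_le
  have h5 : #(((insert v (nbr G v)).sigma fun v => nbr G v).image
        fun p => (⟨p.2, p.1⟩ : Σ _ : V, V)) ≤ _ := card_image_le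
  rw [card_adj_pairs hG] at h5 h2
  have h6 := card_filter_sym2_le F
  have h7 := Nat.mul_le_mul_right d (hins u)
  have h8 := Nat.mul_le_mul_right d (hins v)
  omega

/-- Double counting of switches that remove `uv`: each graph on the left admits at least `M` of
them, and each graph on the right arises from at most `d * d`, since `x` and `y` become neighbours
of `u` and `v`. -/
theorem card_regularContaining_insert_mul_le (d : ℕ) (F : Finset (Sym2 V)) {u v : V}
    (he : s(u, v) ∉ F) (M : ℕ)
    (hM : M + 2 * (#F + 1) + 2 * ((d + 1) * d) ≤ Fintype.card V * d) :
    #(regularContaining d (insert s(u, v) F)) * M ≤ #(regularContaining d F) * (d * d) := by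
  have lower : #(regularContaining d (insert s(u, v) F)) * M ≤
      #((regularContaining d (insert s(u, v) F)).sigma
        fun G => switches G (insert s(u, v) F) u v) := by
    rw [card_sigma, ← smul_eq_mul]
    refine card_nsmul_le_sum _ _ _ fun G hG => ?_
    obtain ⟨hreg, hF⟩ := mem_regularContaining.1 hG
    have := le_card_switches hreg (insert s(u, v) F) (u := u) (v := v)
      (hF _ (mem_insert_self _ _))
    rw [card_insert_of_notMem he] at this
    omega
  have upper : #((regularContaining d F).sigma fun G => nbr G u ×ˢ nbr G v) ≤
      #(regularContaining d F) * (d * d) := by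
    rw [card_sigma, ← smul_eq_mul]
    refine sum_le_card_nsmul _ _ _ fun G hG => ?_
    rw [card_product, (mem_regularContaining.1 hG).1, (mem_regularContaining.1 hG).1]
  refine lower.trans (le_trans ?_ upper)
  refine card_le_card_of_injOn
    (fun q => (⟨edgeSwitch q.1 u v q.2.1 q.2.2, q.2⟩ : Σ _ : SimpleGraph V, V × V)) ?_ ?_
  · rintro ⟨G, x, y⟩ hq
    simp only [coe_sigma, Set.mem_sigma_iff, mem_coe, switches, mem_filter, mem_univ, true_and,
      mem_regularContaining, mem_insert, not_or] at hq
    obtain ⟨⟨hreg, hF⟩, hsw, hne, hxyF⟩ := hq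
    simp only [coe_sigma, Set.mem_sigma_iff, mem_coe, mem_regularContaining, mem_product, mem_nbr]
    refine ⟨⟨fun a => (hsw.card_nbr a).trans (hreg a), fun e heF => ?_⟩, ?_, ?_⟩
    · have := hF e (Or.inr heF)
      induction e with
      | _ a b =>
        rw [SimpleGraph.mem_edgeSet] at this ⊢
        rw [edgeSwitch_adj]
        refine ⟨Or.inl ⟨this, ?_, ?_⟩, this.ne⟩
        · rintro h; exact he (h ▸ heF)
        · rintro h; exact hxyF (h ▸ heF)
    · rw [edgeSwitch_adj]; exact ⟨Or.inr (Or.inl rfl), hsw.ne₁⟩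
    · rw [edgeSwitch_adj]; exact ⟨Or.inr (Or.inr rfl), hsw.ne₂⟩
  -- Injectivity: the reverse switch recovers the original graph from its image and `(x, y)`.
  · rintro ⟨G, x, y⟩ hq ⟨G', x', y'⟩ hq' h
    simp only [coe_sigma, Set.mem_sigma_iff, mem_coe, switches, mem_filter] at hq hq'
    simp only [Sigma.mk.injEq, heq_eq_eq, Prod.mk.injEq] at h
    obtain ⟨h1, rfl, rfl⟩ := h
    have := hq.2.2.1.edgeSwitch_edgeSwitch
    rw [h1, hq'.2.2.1.edgeSwitch_edgeSwitch] at this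
    rw [this]

/-- In a random `d`-regular graph on `n` vertices with `d` not too close to `n`, a given set of `m`
edges is present with probability at most `(2d/n)^m`. -/
theorem card_regularContaining_mul_le (d : ℕ) (F : Finset (Sym2 V))
    (h : 4 * #F + 4 * ((d + 1) * d) ≤ Fintype.card V * d) :
    #(regularContaining d F) * Fintype.card V ^ #F ≤
      #(regularContaining (V := V) d ∅) * (2 * d) ^ #F := by
  induction F using Finset.induction_on with
  | empty => simp
  | insert e F he ih =>
    rw [card_insert_of_notMem he] at h ⊢
    specialize ih (by omega)
    induction e with
    | _ u v =>
      have key := card_regularContaining_insert_mul_le d F he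
        (Fintype.card V * d - 2 * (#F + 1) - 2 * ((d + 1) * d)) (by omega)
      have h2 : Fintype.card V * d ≤
          2 * (Fintype.card V * d - 2 * (#F + 1) - 2 * ((d + 1) * d)) := by omega
      have hd : 0 < d := by
        rcases Nat.eq_zero_or_pos d with rfl | hd
        · simp at h
        · exact hd
      have step : #(regularContaining d (insert s(u, v) F)) * Fintype.card V ≤
          #(regularContaining d F) * (2 * d) := by
        refine Nat.le_of_mul_le_mul_right ?_ hd
        calc _ = #(regularContaining d (insert s(u, v) F)) * (Fintype.card V * d) := by ring
          _ ≤ #(regularContaining d (insert s(u, v) F)) *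
            (2 * (Fintype.card V * d - 2 * (#F + 1) - 2 * ((d + 1) * d))) := by gcongr
          _ = 2 * (#(regularContaining d (insert s(u, v) F)) *
            (Fintype.card V * d - 2 * (#F + 1) - 2 * ((d + 1) * d))) := by ring
          _ ≤ 2 * (#(regularContaining d F) * (d * d)) := by gcongr
          _ = _ := by ring
      calc _ = (#(regularContaining d (insert s(u, v) F)) * Fintype.card V) *
            Fintype.card V ^ #F := by ring
        _ ≤ (#(regularContaining d F) * (2 * d)) * Fintype.card V ^ #F := by gcongr
        _ = (#(regularContaining d F) * Fintype.card V ^ #F) * (2 * d) := by ring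
        _ ≤ (#(regularContaining (V := V) d ∅) * (2 * d) ^ #F) * (2 * d) := by gcongr
        _ = _ := by ring

end Switching

/-! ### Local sparsity of random regular graphs -/

section Sparse

theorem choose_le_exp_mul_div_pow (a b : ℕ) (hb : 0 < b) :
    (a.choose b : ℝ) ≤ (Real.exp 1 * a / b) ^ b := by
  have hb' : (0 : ℝ) < b := by exact_mod_cast hb
  have h1 : (b : ℝ) ^ b / b.factorial ≤ Real.exp b := Real.pow_div_factorial_le_exp _ hb'.le b
  calc (a.choose b : ℝ) ≤ (a : ℝ) ^ b / b.factorial := Nat.choose_le_pow_div b a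
    _ = (a / b : ℝ) ^ b * ((b : ℝ) ^ b / b.factorial) := by
      rw [div_pow]; field_simp
    _ ≤ (a / b : ℝ) ^ b * Real.exp b := by gcongr
    _ = _ := by
      rw [← mul_one (b : ℝ), Real.exp_nat_mul, ← mul_pow, mul_one]
      congr 1; ring

/-- The union bound over `k`-sets and over `m` of the pairs inside each. With `a.choose b ≤ (e * a /
b) ^ b` the edge factor is at most `(15k/n)^(2k)`, which outweighs the `(e * n / k)^k` choices of
the set. -/
theorem union_bound_term_le {n d k m : ℕ} (hk : 0 < k) (hkn : 1250 * k ≤ n) (hd : 10 < d)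
    (hm : 2 * d * k ≤ 11 * m) :
    (n.choose k : ℝ) * ((k.choose 2).choose m : ℝ) * (2 * d / n : ℝ) ^ m ≤
      (625 * k / n : ℝ) ^ k := by
  have hk' : (1 : ℝ) ≤ k := by exact_mod_cast hk
  have hkn' : 1250 * (k : ℝ) ≤ n := by exact_mod_cast hkn
  have hn' : (0 : ℝ) < n := by linarith
  have hd' : (11 : ℝ) ≤ d := by exact_mod_cast hd
  have hm' : 2 * (d : ℝ) * k ≤ 11 * m := by exact_mod_cast hm
  -- Here `d ≥ 11` is essential: `m ≥ 2dk/11 ≥ 2k`.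
  have h2k : 2 * k ≤ m := by nlinarith
  have hm0 : 0 < m := by omega
  have hm0' : (0 : ℝ) < m := by exact_mod_cast hm0
  have he := Real.exp_one_lt_d9
  have he0 := Real.exp_pos 1
  have h1 := choose_le_exp_mul_div_pow n k hk
  have h2 := choose_le_exp_mul_div_pow (k.choose 2) m hm0
  have h3 : ((k.choose 2 : ℕ) : ℝ) ≤ (k : ℝ) ^ 2 / 2 := by
    simpa using Nat.choose_le_pow_div (α := ℝ) 2 k
  -- The constant 15 is an upper bound for `11 * e / 2`; later 625 bounds `225 * e`.
  have h4 : Real.exp 1 * (k.choose 2 : ℕ) / m * (2 * d / n) ≤ 15 * k / n := by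
    rw [div_mul_div_comm, div_le_div_iff₀ (by positivity) hn']
    have : Real.exp 1 * (k.choose 2 : ℕ) * (2 * d) ≤ 15 * k * m := by
      calc Real.exp 1 * (k.choose 2 : ℕ) * (2 * d) ≤ Real.exp 1 * ((k : ℝ) ^ 2 / 2) * (2 * d) := by
            gcongr
        _ = Real.exp 1 / 2 * k * (2 * d * k) := by ring
        _ ≤ Real.exp 1 / 2 * k * (11 * m) := by gcongr
        _ = (11 / 2 * Real.exp 1) * (k * m) := by ring
        _ ≤ 15 * (k * m) := by gcongr; linarith
        _ = _ := by ring
    nlinarith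
  have h5 : 15 * (k : ℝ) / n ≤ 1 := by rw [div_le_one hn']; linarith
  calc (n.choose k : ℝ) * ((k.choose 2).choose m : ℝ) * (2 * d / n : ℝ) ^ m
      ≤ (Real.exp 1 * n / k) ^ k * (Real.exp 1 * (k.choose 2 : ℕ) / m) ^ m *
        (2 * d / n : ℝ) ^ m := by gcongr
    _ = (Real.exp 1 * n / k) ^ k * (Real.exp 1 * (k.choose 2 : ℕ) / m * (2 * d / n)) ^ m := by
      rw [mul_assoc, ← mul_pow]
    _ ≤ (Real.exp 1 * n / k) ^ k * (15 * k / n) ^ m := by gcongr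
    _ ≤ (Real.exp 1 * n / k) ^ k * (15 * k / n) ^ (2 * k) := by
      gcongr ?_ * ?_
      exact pow_le_pow_of_le_one (by positivity) h5 h2k
    _ = (Real.exp 1 * 225 * k / n) ^ k := by
      rw [pow_mul, ← mul_pow]; congr 1; field_simp; norm_num
    _ ≤ _ := by gcongr; linarith

/-- All bases are at most `1/2`, so one factor `625 * k / n` is kept and the others are replaced by
`1/2`; the series of `k / 2^(k-1)` sums to 4. -/
theorem union_bound_sum_le {n : ℕ} (hn : 0 < n) :
    ∑ k ∈ Icc 1 (n / 1250), (625 * k / n : ℝ) ^ k ≤ 2500 / n := by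
  have hn' : (0 : ℝ) < n := by exact_mod_cast hn
  have geo : ∀ K : ℕ, ∑ k ∈ Icc 1 K, (k : ℝ) * (1 / 2) ^ (k - 1) = 4 - (2 * K + 4) * (1 / 2) ^ K := by
    intro K
    induction K with
    | zero => norm_num
    | succ K ih =>
      rw [sum_Icc_succ_top (by omega), ih, Nat.add_sub_cancel, pow_succ]
      push_cast
      ring
  calc ∑ k ∈ Icc 1 (n / 1250), (625 * k / n : ℝ) ^ k
      ≤ ∑ k ∈ Icc 1 (n / 1250), 625 / n * ((k : ℝ) * (1 / 2) ^ (k - 1)) := by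
        refine sum_le_sum fun k hk => ?_
        obtain ⟨hk1, hk2⟩ := mem_Icc.1 hk
        have hkn : 1250 * (k : ℝ) ≤ n := by
          have : 1250 * k ≤ n := by omega
          exact_mod_cast this
        obtain ⟨j, rfl⟩ : ∃ j, k = j + 1 := ⟨k - 1, by omega⟩
        have hx : 625 * ((j + 1 : ℕ) : ℝ) / n ≤ 1 / 2 := by
          rw [div_le_div_iff₀ hn' two_pos]
          linarith
        calc (625 * ((j + 1 : ℕ) : ℝ) / n) ^ (j + 1)
            ≤ 625 * ((j + 1 : ℕ) : ℝ) / n * (1 / 2) ^ j := by rw [pow_succ']; gcongr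
          _ = _ := by rw [Nat.add_sub_cancel]; ring
    _ = 625 / n * (4 - (2 * (n / 1250 : ℕ) + 4) * (1 / 2) ^ (n / 1250)) := by rw [← mul_sum, geo]
    _ ≤ 625 / n * 4 := by
      gcongr
      have : (0 : ℝ) ≤ (2 * (n / 1250 : ℕ) + 4) * (1 / 2) ^ (n / 1250) := by positivity
      linarith
    _ = _ := by ring

variable {V : Type*} [Fintype V] [DecidableEq V]

/-- All small sets of vertices span few edges: on average fewer than `4d/11` per vertex. -/
def Sparse (d : ℕ) (G : SimpleGraph V) : Prop :=
  ∀ U : Finset V, 1250 * #U ≤ Fintype.card V → 11 * ∑ v ∈ U, #(nbr G v ∩ U) ≤ 4 * d * #U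

/-- Covers the degrees comparable to `n`, where the switching estimate is unavailable. Then `11 * #U
≤ 4 * d`, so even a complete graph on `U` has few enough edges. -/
theorem sparse_of_dense {d : ℕ} (G : SimpleGraph V) (hd : Fintype.card V ≤ 8 * d) :
    Sparse d G := by
  intro U hU
  have h1 : ∑ v ∈ U, #(nbr G v ∩ U) ≤ #U * #U := by
    rw [← smul_eq_mul]
    exact sum_le_card_nsmul _ _ _ fun v _ => card_le_card inter_subset_right
  calc 11 * ∑ v ∈ U, #(nbr G v ∩ U) ≤ (11 * #U) * #U := by rw [mul_assoc]; gcongr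
    _ ≤ 4 * d * #U := Nat.mul_le_mul_right _ (by omega)

/-- The degree sum counts each edge inside `U` twice, which leaves more than `2d * #U / 11` edges;
`F` consists of exactly the ceiling of this number, so that the union bound runs over sets of fixed
size. -/
theorem exists_edges_of_not_sparse {d : ℕ} {G : SimpleGraph V} (hG : ¬ Sparse d G) :
    ∃ U : Finset V, 0 < #U ∧ 1250 * #U ≤ Fintype.card V ∧
      ∃ F ⊆ U.offDiag.image fun p : V × V => s(p.1, p.2), #F = (2 * d * #U + 10) / 11 ∧
        ∀ e ∈ F, e ∈ G.edgeSet := by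
  classical
  simp only [Sparse, not_forall, not_le] at hG
  obtain ⟨U, hU, hlt⟩ := hG
  refine ⟨U, ?_, hU, ?_⟩
  · rw [card_pos, nonempty_iff_ne_empty]
    rintro rfl
    simp at hlt
  set E := (U.offDiag.image fun p : V × V => s(p.1, p.2)).filter fun e => e ∈ G.edgeSet with hE
  have h1 : ∑ v ∈ U, #(nbr G v ∩ U) ≤ 2 * #E := by
    rw [← card_sigma]
    refine le_trans ?_ (card_filter_sym2_le E)
    refine card_le_card_of_injOn (fun q => (q.1, q.2)) ?_ ?_
    · rintro ⟨v, w⟩ h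
      simp only [coe_sigma, Set.mem_sigma_iff, mem_coe, mem_inter, mem_nbr] at h
      simp only [hE, mem_coe, mem_filter, mem_univ, true_and, mem_image, SimpleGraph.mem_edgeSet]
      exact ⟨⟨(v, w), by simp [h.1, h.2.2, h.2.1.ne], rfl⟩, h.2.1⟩
    · rintro ⟨v, w⟩ _ ⟨v', w'⟩ _ h
      simpa using h
  obtain ⟨F, hF, hcard⟩ := exists_subset_card_eq (s := E) (n := (2 * d * #U + 10) / 11) (by
    have : 4 * d * #U = 2 * (2 * d * #U) := by ring
    omega)
  exact ⟨F, hF.trans (filter_subset _ _), hcard, fun e he => (mem_filter.1 (hF he)).2⟩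

open Classical in
/-- A random `d`-regular graph is sparse with high probability. -/
theorem card_not_sparse_le {d : ℕ}
    (hd : 10 < d) (hn : 100 ≤ Fintype.card V) :
    (#((regularContaining (V := V) d ∅).filter fun G => ¬ Sparse d G) : ℝ) ≤
      2500 / Fintype.card V * #(regularContaining (V := V) d ∅) := by
  set n := Fintype.card V with hndef
  have hn0 : 0 < n := by omega
  have hn0' : (0 : ℝ) < n := by exact_mod_cast hn0
  rcases le_total n (8 * d) with hdense | hdn
  · rw [filter_false_of_mem (fun G _ => not_not.2 (sparse_of_dense G hdense))]
    simp only [card_empty, Nat.cast_zero]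
    positivity
  set N₀ := #(regularContaining (V := V) d ∅)
  set E : Finset V → Finset (Sym2 V) := fun U => U.offDiag.image fun p : V × V => s(p.1, p.2)
  set μ : ℕ → ℕ := fun k => (2 * d * k + 10) / 11 with hμ
  have hsub : ((regularContaining (V := V) d ∅).filter fun G => ¬ Sparse d G) ⊆
      (Icc 1 (n / 1250)).biUnion fun k => (powersetCard k univ).biUnion fun U =>
        (powersetCard (μ k) (E U)).biUnion fun F => regularContaining d F := by
    intro G hG
    obtain ⟨hG1, hG2⟩ := mem_filter.1 hG
    obtain ⟨U, hU0, hU, F, hFE, hF, hFG⟩ := exists_edges_of_not_sparse hG2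
    simp only [mem_biUnion, mem_powersetCard, mem_Icc]
    exact ⟨#U, ⟨hU0, by omega⟩, U, ⟨subset_univ _, rfl⟩, F, ⟨hFE, hF⟩,
      mem_regularContaining.2 ⟨(mem_regularContaining.1 hG1).1, hFG⟩⟩
  have hbound : ∀ k ∈ Icc 1 (n / 1250), ∀ U ∈ powersetCard k (univ : Finset V),
      ∀ F ∈ powersetCard (μ k) (E U),
      (#(regularContaining d F) : ℝ) ≤ N₀ * (2 * d / n) ^ μ k := by
    intro k hk U hU F hF
    obtain ⟨hFE, hFc⟩ := mem_powersetCard.1 hF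
    obtain ⟨hk1, hk2⟩ := mem_Icc.1 hk
    -- Since `n ≥ 8 * d`, half of `n * d` absorbs the `4 * d * d` of the side condition; `1250 * k ≤
    -- n` and `n ≥ 100` take care of the lower-order terms.
    have h1 := card_regularContaining_mul_le d F (by
      rw [hFc, ← hndef, hμ]
      have a1 : 1250 * (d * k) ≤ n * d := by
        have : 1250 * k ≤ n := by omega
        nlinarith
      have a2 : 8 * (d * d) ≤ n * d := by nlinarith
      have a3 : 100 * d ≤ n * d := by nlinarith
      have a4 : 2 * d * k = 2 * (d * k) := by ring
      have a5 : (d + 1) * d = d * d + d := by ring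
      simp only [a4, a5]
      omega)
    rw [hFc, ← hndef] at h1
    have h2 : (#(regularContaining d F) : ℝ) * n ^ μ k ≤ N₀ * (2 * d) ^ μ k := by exact_mod_cast h1
    rw [div_pow, mul_div_assoc', le_div_iff₀ (by positivity)]
    exact h2
  calc (#((regularContaining (V := V) d ∅).filter fun G => ¬ Sparse d G) : ℝ)
      ≤ ∑ k ∈ Icc 1 (n / 1250), ∑ U ∈ powersetCard k (univ : Finset V),
        ∑ F ∈ powersetCard (μ k) (E U), (#(regularContaining d F) : ℝ) := by
        have h1 := (card_le_card hsub).trans (card_biUnion_le.trans (sum_le_sum fun k _ =>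
          card_biUnion_le.trans (sum_le_sum fun U _ => card_biUnion_le)))
        exact_mod_cast h1
    _ ≤ ∑ k ∈ Icc 1 (n / 1250), N₀ * (625 * k / n : ℝ) ^ k := by
        refine sum_le_sum fun k hk => ?_
        obtain ⟨hk1, hk2⟩ := mem_Icc.1 hk
        calc _ ≤ ∑ U ∈ powersetCard k (univ : Finset V), ∑ F ∈ powersetCard (μ k) (E U),
              (N₀ * (2 * d / n) ^ μ k : ℝ) :=
              sum_le_sum fun U hU => sum_le_sum fun F hF => hbound k hk U hU F hF
          _ = ∑ U ∈ powersetCard k (univ : Finset V),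
              (((k.choose 2).choose (μ k) : ℕ) : ℝ) * (N₀ * (2 * d / n) ^ μ k : ℝ) := by
              refine sum_congr rfl fun U hU => ?_
              rw [sum_const, card_powersetCard, nsmul_eq_mul]
              congr 4
              rw [← (mem_powersetCard.1 hU).2]
              exact Sym2.card_image_offDiag U
          _ = N₀ * ((n.choose k : ℝ) * ((k.choose 2).choose (μ k) : ℝ) * (2 * d / n : ℝ) ^ μ k) := by
              rw [sum_const, card_powersetCard, nsmul_eq_mul, card_univ]
              ring
          _ ≤ _ := by
              gcongr
              exact union_bound_term_le hk1 (by omega) hd (by simp only [hμ]; omega)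
    _ ≤ N₀ * (2500 / n) := by
        rw [← mul_sum]
        gcongr
        exact union_bound_sum_le hn0
    _ = _ := by ring

end Sparse

/-! ### One voting step on a sparse graph: contraction and concentration -/

section OneStep

variable {V : Type*} [Fintype V] [DecidableEq V]

theorem sum_card_nbr_inter_comm (G : SimpleGraph V) (S T : Finset V) :
    ∑ v ∈ S, #(nbr G v ∩ T) = ∑ v ∈ T, #(nbr G v ∩ S) := by
  classical
  have h := sum_card_bipartiteAbove_eq_sum_card_bipartiteBelow (s := S) (t := T) G.Adj
  convert h using 3 with v _ v _
  · ext w; simp [bipartiteAbove, and_comm]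
  · ext w; simp [bipartiteBelow, and_comm, G.adj_comm]

theorem sum_card_nbr_inter {G : SimpleGraph V} {d : ℕ} (hreg : ∀ v, #(nbr G v) = d)
    (B : Finset V) : ∑ v, #(nbr G v ∩ B) = d * #B := by
  rw [sum_card_nbr_inter_comm]
  simp [hreg, mul_comm]

/-- The number of neighbours in a small set `B`: second moment outside `B` and first moment inside
`B`. -/
theorem Sparse.sum_sq_add_le {G : SimpleGraph V} {d : ℕ} (hreg : ∀ v, #(nbr G v) = d)
    (hd : 0 < d) (hG : Sparse d G) {B : Finset V} (hB : 10000 * #B ≤ Fintype.card V) :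
    11 * (∑ v ∈ Bᶜ, (#(nbr G v ∩ B) : ℝ) ^ 2 + 2 * d * ∑ v ∈ B, (#(nbr G v ∩ B) : ℝ)) ≤
      10 * d ^ 2 * #B := by
  set b : V → ℕ := fun v => #(nbr G v ∩ B) with hb
  -- The threshold `2d/11` is half the sparsity constant `4d/11`; this makes the `#T` terms cancel
  -- at the end.
  set T : Finset V := Bᶜ.filter fun v => 2 * d < 11 * b v with hT
  have hbd : ∀ v, b v ≤ d := fun v => (card_le_card inter_subset_left).trans (hreg v).le
  have hsum : ∑ v ∈ B, b v + ∑ v ∈ Bᶜ, b v = d * #B := by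
    rw [sum_add_sum_compl]; exact sum_card_nbr_inter hreg B
  have hTsub : ∑ v ∈ T, b v ≤ ∑ v ∈ Bᶜ, b v :=
    sum_le_sum_of_subset (filter_subset _ _)
  have hTcard : 2 * #T ≤ 11 * #B := by
    have h1 : #T * (2 * d) ≤ ∑ v ∈ T, 11 * b v := by
      rw [← smul_eq_mul]
      exact card_nsmul_le_sum _ _ _ fun v hv => (mem_filter.1 hv).2.le
    rw [← mul_sum] at h1
    have h2 : ∑ v ∈ T, b v ≤ d * #B := by omega
    refine Nat.le_of_mul_le_mul_right (c := d) ?_ hd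
    linarith
  have hdisj : Disjoint B T := by
    rw [disjoint_left]
    intro v hv hvT
    exact (mem_compl.1 (mem_filter.1 hvT).1) hv
  -- The union has at most `6.5 * #B` vertices, and `6.5 * 1250 ≤ 10000`.
  have hBT := hG (B ∪ T) (by rw [card_union_of_disjoint hdisj]; omega)
  have hBB := hG B (by omega)
  -- Edges between `B` and `T` are counted from both ends.
  have hlow : ∑ v ∈ B, b v + 2 * ∑ v ∈ T, b v ≤ ∑ v ∈ B ∪ T, #(nbr G v ∩ (B ∪ T)) := by
    rw [sum_union hdisj, two_mul, ← add_assoc]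
    refine add_le_add ?_ (sum_le_sum fun v _ =>
      card_le_card (inter_subset_inter_left subset_union_left))
    rw [← sum_card_nbr_inter_comm G B T, ← sum_add_distrib]
    refine sum_le_sum fun v _ => ?_
    rw [inter_union_distrib_left, card_union_of_disjoint]
    exact hdisj.mono inter_subset_right inter_subset_right
  rw [card_union_of_disjoint hdisj] at hBT
  -- Off `T` the square is at most `(2d/11) * b`. On `T` it lies below its chord on `[2d/11, d]`,
  -- that is, `(11 * b - 2 * d) * (b - d) ≤ 0`.
  have hsq : ∑ v ∈ Bᶜ, 11 * (b v : ℝ) ^ 2 ≤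
      ∑ v ∈ Bᶜ, 2 * d * (b v : ℝ) + ∑ v ∈ T, (d * (11 * (b v : ℝ)) - d * (2 * d)) := by
    rw [hT, sum_filter, ← sum_add_distrib]
    refine sum_le_sum fun v _ => ?_
    have h1 : (b v : ℝ) ≤ d := by exact_mod_cast hbd v
    have h0 : (0 : ℝ) ≤ b v := by positivity
    split_ifs with h
    · have h2 : 2 * (d : ℝ) < 11 * b v := by exact_mod_cast h
      nlinarith
    · have h2 : 11 * (b v : ℝ) ≤ 2 * d := by exact_mod_cast not_lt.1 h
      nlinarith
  rw [← mul_sum, ← mul_sum, sum_sub_distrib, ← mul_sum, ← mul_sum, sum_const, nsmul_eq_mul] at hsq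
  have e1 : (∑ v ∈ B, (b v : ℝ)) + ∑ v ∈ Bᶜ, (b v : ℝ) = d * #B := by exact_mod_cast hsum
  have e2 : 11 * ((∑ v ∈ B, (b v : ℝ)) + 2 * ∑ v ∈ T, (b v : ℝ)) ≤ 4 * d * (#B + #T) := by
    exact_mod_cast (Nat.mul_le_mul_left 11 hlow).trans hBT
  have e3 : 11 * (∑ v ∈ B, (b v : ℝ)) ≤ 4 * d * #B := by exact_mod_cast hBB
  have hd' : (0 : ℝ) < d := by exact_mod_cast hd
  change 11 * (∑ v ∈ Bᶜ, (b v : ℝ) ^ 2 + 2 * d * ∑ v ∈ B, (b v : ℝ)) ≤ 10 * d ^ 2 * #B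
  set X := ∑ v ∈ B, (b v : ℝ)
  set Y := ∑ v ∈ T, (b v : ℝ)
  set Z := ∑ v ∈ Bᶜ, (b v : ℝ)
  have hZ : Z = d * #B - X := by linarith
  rw [hZ] at hsq
  -- Half of `f2` bounds `11 * d * Y` and cancels `2 * d ^ 2 * #T` in `hsq`. What remains is `4 * d
  -- ^ 2 * #B + 14.5 * d * X`, and `f3` turns this into less than `10 * d ^ 2 * #B`.
  have f2 := mul_le_mul_of_nonneg_left e2 hd'.le
  have f3 := mul_le_mul_of_nonneg_left e3 hd'.le
  nlinarith [sq_nonneg (d : ℝ), Nat.cast_nonneg (α := ℝ) #B,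
    mul_nonneg (sq_nonneg (d : ℝ)) (Nat.cast_nonneg (α := ℝ) #B)]

/-- The vertex `v` has opinion `B` after it has queried the pair `p`. -/
def Adopts (B : Finset V) (v : V) (p : V × V) : Prop :=
  if (p.1 ∈ B ↔ p.2 ∈ B) then p.1 ∈ B else v ∈ B

instance (B : Finset V) (v : V) (p : V × V) : Decidable (Adopts B v p) := by
  unfold Adopts; infer_instance

theorem mem_vote {B : Finset V} {ω : V → V × V} {v : V} : v ∈ vote B ω ↔ Adopts B v (ω v) := by
  simp [vote, Adopts]

theorem adopts_of_notMem {V : Type*} [DecidableEq V] {B : Finset V} {v : V} (hv : v ∉ B)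
    {p : V × V} :
    Adopts B v p ↔ p.1 ∈ B ∧ p.2 ∈ B := by
  unfold Adopts; split_ifs <;> tauto

theorem adopts_of_mem {V : Type*} [DecidableEq V] {B : Finset V} {v : V} (hv : v ∈ B)
    {p : V × V} :
    Adopts B v p ↔ p.1 ∈ B ∨ p.2 ∈ B := by
  unfold Adopts; split_ifs <;> tauto

theorem neighbourPairs_withReplacement {V : Type*} [Fintype V] (G : SimpleGraph V) (v : V) :
    neighbourPairs .withReplacement G v = nbr G v ×ˢ nbr G v := by
  ext p; simp [neighbourPairs]

theorem neighbourPairs_withoutReplacement {V : Type*} [Fintype V] (G : SimpleGraph V) (v : V) :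
    neighbourPairs .withoutReplacement G v = (nbr G v).offDiag := by
  ext p; simp [neighbourPairs]

theorem samples_eq_neighbourPairs {V : Type*} [Fintype V] {G : SimpleGraph V} {v : V}
    (h : 2 ≤ #(nbr G v))
    (m : Sampling) : samples m G v = neighbourPairs m G v := by
  obtain ⟨x, hx, y, hy, hxy⟩ := one_lt_card.1 h
  rw [samples, if_pos]
  refine ⟨(x, y), ?_⟩
  cases m
  · rw [neighbourPairs_withReplacement]; exact mem_product.2 ⟨hx, hy⟩
  · rw [neighbourPairs_withoutReplacement]; exact mem_offDiag.2 ⟨hx, hy, hxy⟩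

/-- The probability that `v` has opinion `B` after one step. -/
noncomputable def adoptProb (m : Sampling) (G : SimpleGraph V) (B : Finset V) (v : V) : ℝ :=
  #((samples m G v).filter (Adopts B v)) / #(samples m G v)

/-- Both queries must hit `B`. Sampling without replacement only helps: `b(b-1)/(d(d-1)) ≤ b²/d²`
for `b ≤ d`. -/
theorem adoptProb_le_of_notMem {G : SimpleGraph V} {v : V} {d : ℕ} (hd : 2 ≤ d)
    (hreg : #(nbr G v) = d) (m : Sampling) {B : Finset V} (hv : v ∉ B) :
    adoptProb m G B v ≤ (#(nbr G v ∩ B) : ℝ) ^ 2 / d ^ 2 := by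
  have hd' : (2 : ℝ) ≤ d := by exact_mod_cast hd
  have hbd : #(nbr G v ∩ B) ≤ d := hreg ▸ card_le_card inter_subset_left
  have hbd' : (#(nbr G v ∩ B) : ℝ) ≤ d := by exact_mod_cast hbd
  rw [adoptProb, samples_eq_neighbourPairs (hreg.symm ▸ hd)]
  cases m
  · rw [neighbourPairs_withReplacement]
    have : (nbr G v ×ˢ nbr G v).filter (Adopts B v) = (nbr G v ∩ B) ×ˢ (nbr G v ∩ B) := by
      ext p; simp [adopts_of_notMem hv]; tauto
    rw [this, card_product, card_product, hreg]
    push_cast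
    rw [sq, sq]
  · rw [neighbourPairs_withoutReplacement]
    have : (nbr G v).offDiag.filter (Adopts B v) = (nbr G v ∩ B).offDiag := by
      ext p; simp [adopts_of_notMem hv]; tauto
    rw [this, offDiag_card, offDiag_card, hreg, Nat.cast_sub (Nat.le_mul_self _),
      Nat.cast_sub (Nat.le_mul_self _)]
    push_cast
    set b := (#(nbr G v ∩ B) : ℝ)
    have hb : 0 ≤ b := by positivity
    rw [div_le_div_iff₀ (by nlinarith) (by positivity)]
    have := mul_nonneg (mul_nonneg hb (by linarith : (0 : ℝ) ≤ d)) (sub_nonneg.2 hbd')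
    nlinarith

/-- To stay in `B`, at least one query must hit `B`: a union bound over two queries, each uniform on
the neighbours. -/
theorem adoptProb_le_of_mem {G : SimpleGraph V} {v : V} {d : ℕ} (hd : 2 ≤ d)
    (hreg : #(nbr G v) = d) (m : Sampling) {B : Finset V} (hv : v ∈ B) :
    adoptProb m G B v ≤ 2 * #(nbr G v ∩ B) / d := by
  have hd' : (2 : ℝ) ≤ d := by exact_mod_cast hd
  rw [adoptProb, samples_eq_neighbourPairs (hreg.symm ▸ hd)]
  cases m
  · rw [neighbourPairs_withReplacement]
    have : (nbr G v ×ˢ nbr G v).filter (Adopts B v) ⊆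
        ((nbr G v ∩ B) ×ˢ nbr G v) ∪ (nbr G v ×ˢ (nbr G v ∩ B)) := by
      intro p; simp [adopts_of_mem hv]; tauto
    have h1 := (card_le_card this).trans (card_union_le _ _)
    rw [card_product, card_product, hreg] at h1
    have h2 : (#((nbr G v ×ˢ nbr G v).filter (Adopts B v)) : ℝ) ≤
      #(nbr G v ∩ B) * d + d * #(nbr G v ∩ B) := by exact_mod_cast h1
    rw [card_product, hreg, div_le_div_iff₀ (by push_cast; positivity) (by positivity)]
    push_cast
    nlinarith
  · rw [neighbourPairs_withoutReplacement]
    have : (nbr G v).offDiag.filter (Adopts B v) ⊆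
        (((nbr G v ∩ B).sigma fun x => (nbr G v).erase x).image fun q => (q.1, q.2)) ∪
        (((nbr G v ∩ B).sigma fun x => (nbr G v).erase x).image fun q => (q.2, q.1)) := by
      rintro ⟨x, y⟩ hp
      simp only [mem_filter, mem_offDiag, adopts_of_mem hv] at hp
      obtain ⟨⟨hx, hy, hne⟩, h | h⟩ := hp
      · exact mem_union_left _ (mem_image.2 ⟨⟨x, y⟩, by simp_all [Ne.symm], rfl⟩)
      · exact mem_union_right _ (mem_image.2 ⟨⟨y, x⟩, by simp_all [Ne.symm], rfl⟩)
    have hs : #((nbr G v ∩ B).sigma fun x => (nbr G v).erase x) = #(nbr G v ∩ B) * (d - 1) := by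
      rw [card_sigma, ← smul_eq_mul]
      refine sum_eq_card_nsmul fun x hx => ?_
      rw [card_erase_of_mem (mem_inter.1 hx).1, hreg]
    have h1 := (card_le_card this).trans ((card_union_le _ _).trans
      (add_le_add card_image_le card_image_le))
    rw [hs] at h1
    have h2 : (#((nbr G v).offDiag.filter (Adopts B v)) : ℝ) ≤
      #(nbr G v ∩ B) * (d - 1) + #(nbr G v ∩ B) * (d - 1) := by
      have : ((d - 1 : ℕ) : ℝ) = d - 1 := by push_cast [Nat.cast_sub (by omega : 1 ≤ d)]; ring
      rw [← this]
      exact_mod_cast h1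
    rw [offDiag_card, hreg, Nat.cast_sub (Nat.le_mul_self _), Nat.cast_mul,
      div_le_div_iff₀ (by nlinarith) (by positivity)]
    nlinarith

/-- The expected number of vertices with opinion `B` decreases by a constant factor. -/
theorem Sparse.sum_adoptProb_le {G : SimpleGraph V} {d : ℕ} (hreg : ∀ v, #(nbr G v) = d)
    (hd : 2 ≤ d) (hG : Sparse d G) (m : Sampling) {B : Finset V}
    (hB : 10000 * #B ≤ Fintype.card V) :
    ∑ v, adoptProb m G B v ≤ 10 / 11 * #B := by
  have hd' : (2 : ℝ) ≤ d := by exact_mod_cast hd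
  have h := hG.sum_sq_add_le hreg (by omega) hB
  calc ∑ v, adoptProb m G B v
      = ∑ v ∈ Bᶜ, adoptProb m G B v + ∑ v ∈ B, adoptProb m G B v :=
        (sum_compl_add_sum _ _).symm
    _ ≤ ∑ v ∈ Bᶜ, (#(nbr G v ∩ B) : ℝ) ^ 2 / d ^ 2 + ∑ v ∈ B, 2 * (#(nbr G v ∩ B) : ℝ) / d := by
        gcongr with v hv v hv
        · exact adoptProb_le_of_notMem hd (hreg v) m (mem_compl.1 hv)
        · exact adoptProb_le_of_mem hd (hreg v) m hv
    _ = (∑ v ∈ Bᶜ, (#(nbr G v ∩ B) : ℝ) ^ 2 + 2 * d * ∑ v ∈ B, (#(nbr G v ∩ B) : ℝ)) / d ^ 2 := by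
        rw [← sum_div, ← sum_div, ← mul_sum]
        field_simp
    _ ≤ _ := by
        rw [div_le_iff₀ (by positivity)]
        linarith

/-- Independence of the vertices' samples, in counting form. -/
theorem sum_piFinset_samples_prod (m : Sampling) (G : SimpleGraph V) (f : V → V × V → ℝ) :
    ∑ ω ∈ Fintype.piFinset (samples m G), ∏ v, f v (ω v) = ∏ v, ∑ p ∈ samples m G v, f v p :=
  (prod_univ_sum _ _).symm

theorem card_filter_adopts (m : Sampling) (G : SimpleGraph V) (B : Finset V) (v : V) :
    (#((samples m G v).filter (Adopts B v)) : ℝ) = adoptProb m G B v * #(samples m G v) := by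
  have : (0 : ℝ) < #(samples m G v) := by exact_mod_cast card_pos.2 (samples_nonempty m G v)
  rw [adoptProb, div_mul_cancel₀ _ this.ne']

theorem card_filter_mem_vote (m : Sampling) (G : SimpleGraph V) (B : Finset V) (v : V) :
    (#((Fintype.piFinset (samples m G)).filter fun ω => v ∈ vote B ω) : ℝ) =
      adoptProb m G B v * #(Fintype.piFinset (samples m G)) := by
  have h := sum_piFinset_samples_prod m G
    fun w p => if w = v then (if Adopts B v p then 1 else 0) else 1
  have h1 : ∀ ω : V → V × V, (∏ w, if w = v then (if Adopts B v (ω w) then (1 : ℝ) else 0) else 1) =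
      if v ∈ vote B ω then 1 else 0 := fun ω => by
    rw [prod_ite_eq' univ v (fun w => if Adopts B v (ω w) then (1 : ℝ) else 0)]
    simp [mem_vote]
  simp only [h1] at h
  rw [sum_boole] at h
  rw [h, Fintype.card_piFinset, Nat.cast_prod, ← mul_prod_erase univ _ (mem_univ v),
    ← mul_prod_erase univ (fun w => (#(samples m G w) : ℝ)) (mem_univ v), ← mul_assoc]
  congr 1
  · simp [card_filter_adopts]
  · refine prod_congr rfl fun w hw => ?_
    simp [ne_of_mem_erase hw]

theorem Sparse.sum_card_vote_le {G : SimpleGraph V} {d : ℕ} (hreg : ∀ v, #(nbr G v) = d)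
    (hd : 2 ≤ d) (hG : Sparse d G) (m : Sampling) {B : Finset V}
    (hB : 10000 * #B ≤ Fintype.card V) :
    ∑ ω ∈ Fintype.piFinset (samples m G), (#(vote B ω) : ℝ) ≤
      10 / 11 * #B * #(Fintype.piFinset (samples m G)) := by
  calc ∑ ω ∈ Fintype.piFinset (samples m G), (#(vote B ω) : ℝ)
      = ∑ ω ∈ Fintype.piFinset (samples m G), ∑ v, if v ∈ vote B ω then (1 : ℝ) else 0 := by
        simp
    _ = ∑ v, adoptProb m G B v * #(Fintype.piFinset (samples m G)) := by
        rw [sum_comm]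
        refine sum_congr rfl fun v _ => ?_
        rw [sum_boole, card_filter_mem_vote]
    _ ≤ _ := by
        rw [← sum_mul]
        gcongr
        exact hG.sum_adoptProb_le hreg hd m hB

/-- The Chernoff bound on the moment generating function: the votes are independent Bernoulli
variables, and `1 + (e^θ - 1) * p ≤ exp ((e^θ - 1) * p)`. -/
theorem sum_exp_card_vote_le (m : Sampling) (G : SimpleGraph V) (B : Finset V) (θ : ℝ) :
    ∑ ω ∈ Fintype.piFinset (samples m G), Real.exp (θ * #(vote B ω)) ≤
      Real.exp ((Real.exp θ - 1) * ∑ v, adoptProb m G B v) *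
        #(Fintype.piFinset (samples m G)) := by
  have h1 : ∀ ω : V → V × V, Real.exp (θ * #(vote B ω)) =
      ∏ v, Real.exp (if Adopts B v (ω v) then θ else 0) := fun ω => by
    rw [← Real.exp_sum, ← sum_filter, sum_const, nsmul_eq_mul, mul_comm]
    congr 4
  simp only [h1]
  rw [sum_piFinset_samples_prod m G fun v p => Real.exp (if Adopts B v p then θ else 0),
    mul_sum, Real.exp_sum, Fintype.card_piFinset, Nat.cast_prod, ← prod_mul_distrib]
  refine prod_le_prod (fun v _ => sum_nonneg fun p _ => (Real.exp_pos _).le) fun v _ => ?_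
  calc ∑ p ∈ samples m G v, Real.exp (if Adopts B v p then θ else 0)
      = ∑ p ∈ samples m G v, (1 + (Real.exp θ - 1) * if Adopts B v p then 1 else 0) := by
        refine sum_congr rfl fun p _ => ?_
        split_ifs <;> simp
    _ = ((Real.exp θ - 1) * adoptProb m G B v + 1) * #(samples m G v) := by
        rw [sum_add_distrib, ← mul_sum, sum_boole, card_filter_adopts, sum_const, nsmul_eq_mul]
        ring
    _ ≤ _ := by
        gcongr
        exact Real.add_one_le_exp _

theorem exp_one_tenth_le : Real.exp (1 / 10) ≤ 1.106 := by
  refine le_of_pow_le_pow_left₀ (n := 10) (by norm_num) (by norm_num) ?_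
  rw [← Real.exp_nat_mul]
  norm_num
  exact Real.exp_one_lt_d9.le.trans (by norm_num)

/-- The number of vertices with opinion `B` is unlikely to exceed a bound that it obeys. -/
theorem Sparse.card_filter_lt_card_vote_le {G : SimpleGraph V} {d : ℕ}
    (hreg : ∀ v, #(nbr G v) = d) (hd : 2 ≤ d) (hG : Sparse d G) (m : Sampling) {B : Finset V}
    (hB : 10000 * #B ≤ Fintype.card V) {M : ℝ} (hM : (#B : ℝ) ≤ M) :
    (#((Fintype.piFinset (samples m G)).filter fun ω => M < #(vote B ω)) : ℝ) ≤
      Real.exp (-(M / 500)) * #(Fintype.piFinset (samples m G)) := by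
  have hM0 : 0 ≤ M := (Nat.cast_nonneg _).trans hM
  have h1 : (#((Fintype.piFinset (samples m G)).filter fun ω => M < #(vote B ω)) : ℝ) *
      Real.exp (1 / 10 * M) ≤
      ∑ ω ∈ Fintype.piFinset (samples m G), Real.exp (1 / 10 * #(vote B ω)) := by
    rw [← nsmul_eq_mul]
    refine (card_nsmul_le_sum _ (fun ω => Real.exp (1 / 10 * #(vote B ω))) _
      fun ω hω => ?_).trans
      (sum_le_sum_of_subset_of_nonneg (filter_subset _ _) fun _ _ _ => (Real.exp_pos _).le)
    have := (mem_filter.1 hω).2.le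
    gcongr
  have h2 := h1.trans (sum_exp_card_vote_le m G B (1 / 10))
  -- At `θ = 1/10` the exponent `0.106 * 10/11 < 0.0965` stays below `0.1` by more than `1/500`, the
  -- rate claimed.
  have h3 : (Real.exp (1 / 10) - 1) * ∑ v, adoptProb m G B v ≤ 0.0965 * M := by
    have e1 : Real.exp (1 / 10) - 1 ≤ 0.106 := by linarith [exp_one_tenth_le]
    have e2 : 0 ≤ Real.exp (1 / 10) - 1 := by linarith [Real.add_one_le_exp (1 / 10 : ℝ)]
    calc _ ≤ (Real.exp (1 / 10) - 1) * (10 / 11 * M) := by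
          gcongr
          exact (hG.sum_adoptProb_le hreg hd m hB).trans (by gcongr)
      _ ≤ 0.106 * (10 / 11 * M) := by gcongr
      _ ≤ _ := by linarith
  have h4 : Real.exp ((Real.exp (1 / 10) - 1) * ∑ v, adoptProb m G B v) ≤
      Real.exp (-(M / 500)) * Real.exp (1 / 10 * M) := by
    rw [← Real.exp_add]
    gcongr
    linarith
  refine le_of_mul_le_mul_right (h2.trans ?_) (Real.exp_pos (1 / 10 * M))
  calc _ ≤ Real.exp (-(M / 500)) * Real.exp (1 / 10 * M) *
        #(Fintype.piFinset (samples m G)) := by gcongr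
    _ = _ := by ring

end OneStep

/-! ### The whole process: expectations, escape probability and decay -/

section Voting

open scoped ENNReal

/-- The expectation of an `ℝ≥0∞`-valued function. -/
noncomputable def pmfExpect {α : Type*} (p : PMF α) (f : α → ℝ≥0∞) : ℝ≥0∞ := ∑' a, p a * f a

theorem pmfExpect_pure {α : Type*} (a : α) (f : α → ℝ≥0∞) : pmfExpect (PMF.pure a) f = f a := by
  rw [pmfExpect, tsum_eq_single a]
  · simp
  · intro b hb; simp [hb]

theorem pmfExpect_bind {α β : Type*} (p : PMF α) (q : α → PMF β) (f : β → ℝ≥0∞) :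
    pmfExpect (p.bind q) f = pmfExpect p fun a => pmfExpect (q a) f := by
  simp only [pmfExpect, PMF.bind_apply, ← ENNReal.tsum_mul_right, ← ENNReal.tsum_mul_left]
  rw [ENNReal.tsum_comm]
  simp only [mul_assoc]

theorem pmfExpect_map {α β : Type*} (p : PMF α) (g : α → β) (f : β → ℝ≥0∞) :
    pmfExpect (p.map g) f = pmfExpect p (f ∘ g) := by
  rw [← PMF.bind_pure_comp, pmfExpect_bind]
  simp [pmfExpect_pure, Function.comp_def]

theorem pmfExpect_mono {α : Type*} (p : PMF α) {f g : α → ℝ≥0∞} (h : ∀ a, f a ≤ g a) :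
    pmfExpect p f ≤ pmfExpect p g :=
  ENNReal.tsum_le_tsum fun a => mul_le_mul_right (h a) (p a)

theorem pmfExpect_add {α : Type*} (p : PMF α) (f g : α → ℝ≥0∞) :
    pmfExpect p (fun a => f a + g a) = pmfExpect p f + pmfExpect p g := by
  simp only [pmfExpect, mul_add, ENNReal.tsum_add]

theorem pmfExpect_const {α : Type*} (p : PMF α) (c : ℝ≥0∞) : pmfExpect p (fun _ => c) = c := by
  rw [pmfExpect, ENNReal.tsum_mul_right, p.tsum_coe, one_mul]

theorem pmfExpect_const_mul {α : Type*} (p : PMF α) (c : ℝ≥0∞) (f : α → ℝ≥0∞) :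
    pmfExpect p (fun a => c * f a) = c * pmfExpect p f := by
  simp only [pmfExpect, ← ENNReal.tsum_mul_left, mul_left_comm]

theorem pmfExpect_uniformOfFinset_le {α : Type*} {s : Finset α} (hs : s.Nonempty) {f : α → ℝ≥0∞}
    {c : ℝ≥0∞} (h : ∑ a ∈ s, f a ≤ c * #s) : pmfExpect (PMF.uniformOfFinset s hs) f ≤ c := by
  classical
  have h0 : (#s : ℝ≥0∞) ≠ 0 := by simpa using hs.ne_empty
  rw [pmfExpect, tsum_eq_sum (s := s) fun a ha => by
    rw [PMF.uniformOfFinset_apply_of_notMem hs ha, zero_mul]]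
  calc ∑ a ∈ s, PMF.uniformOfFinset s hs a * f a = (#s : ℝ≥0∞)⁻¹ * ∑ a ∈ s, f a := by
        rw [mul_sum]
        exact sum_congr rfl fun a ha => by rw [PMF.uniformOfFinset_apply_of_mem hs ha]
    _ ≤ (#s : ℝ≥0∞)⁻¹ * (c * #s) := by gcongr
    _ = c := by
        rw [mul_left_comm, ENNReal.inv_mul_cancel h0 (ENNReal.natCast_ne_top _), mul_one]

open Classical in
/-- The indicator function of a predicate. -/
noncomputable def ind {α : Type*} (P : α → Prop) (a : α) : ℝ≥0∞ := if P a then 1 else 0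

open Classical in
theorem sum_ind {α : Type*} (s : Finset α) (P : α → Prop) :
    ∑ a ∈ s, ind P a = #(s.filter P) := by
  simp only [ind]
  exact sum_boole P s

theorem ind_le_one {α : Type*} (P : α → Prop) (a : α) : ind P a ≤ 1 := by
  unfold ind; split_ifs <;> simp

theorem one_sub_le_toReal_apply {α : Type*} (p : PMF α) (a : α) {ε : ℝ} (hε : 0 ≤ ε)
    (h : pmfExpect p (ind (· ≠ a)) ≤ ENNReal.ofReal ε) : 1 - ε ≤ (p a).toReal := by
  have h1 : (1 : ℝ≥0∞) ≤ p a + ENNReal.ofReal ε := by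
    refine le_trans ?_ (add_le_add_right h _)
    rw [← p.tsum_coe]
    classical
    have : p a = pmfExpect p (ind (· = a)) := by
      rw [pmfExpect, tsum_eq_single a]
      · simp [ind]
      · intro b hb; simp [ind, hb]
    rw [this, ← pmfExpect_add, pmfExpect]
    refine ENNReal.tsum_le_tsum fun b => ?_
    by_cases hb : b = a <;> simp [ind, hb]
  have h2 := ENNReal.toReal_mono (by simp [p.apply_ne_top]) h1
  rw [ENNReal.toReal_add (p.apply_ne_top a) ENNReal.ofReal_ne_top,
    ENNReal.toReal_ofReal hε, ENNReal.toReal_one] at h2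
  linarith

variable {V : Type*} [Fintype V] [DecidableEq V]

theorem expect_votingHistory_succ (m : Sampling) (G : SimpleGraph V) (adv : Adversary V)
    (B₀ : Finset V) (t : ℕ) (f : Finset V → ℝ≥0∞) :
    pmfExpect (votingHistory m G adv B₀ (t + 1)) (fun s => f s.1) =
      pmfExpect (votingHistory m G adv B₀ t) fun s =>
        pmfExpect (roundLaw m G) fun ω => f (vote (adv.move s.2 s.1) ω) := by
  rw [votingHistory, pmfExpect_bind]
  simp only [pmfExpect_map, Function.comp_def]

/-- The indicator on the right makes the bound trivial for large `B`, so that it holds for all `B`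
and can be iterated without conditioning. `Sparse.expect_card_vote_le` has the same form, with `n`
as the trivial bound. -/
theorem Sparse.expect_ind_le {G : SimpleGraph V} {d : ℕ}
    (hreg : ∀ v, #(nbr G v) = d) (hd : 2 ≤ d) (hG : Sparse d G) (m : Sampling) {M : ℝ}
    (hM : 10000 * M ≤ Fintype.card V) (B : Finset V) :
    pmfExpect (roundLaw m G) (fun ω => ind (fun A : Finset V => M < #A) (vote B ω)) ≤
      ind (fun A : Finset V => M < #A) B + ENNReal.ofReal (Real.exp (-(M / 500))) := by
  by_cases hB : M < #B
  · refine (pmfExpect_mono _ fun ω => ind_le_one _ _).trans ?_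
    rw [pmfExpect_const]
    simp [ind, hB]
  · rw [not_lt] at hB
    refine le_trans ?_ le_add_self
    refine pmfExpect_uniformOfFinset_le _ ?_
    have h10 : 10000 * #B ≤ Fintype.card V := by
      have : 10000 * (#B : ℝ) ≤ Fintype.card V := by linarith
      exact_mod_cast this
    have h := hG.card_filter_lt_card_vote_le hreg hd m h10 hB
    change ∑ ω ∈ _, ind (fun ω => M < (#(vote B ω) : ℝ)) ω ≤ _
    rw [sum_ind, ← ENNReal.ofReal_natCast, ← ENNReal.ofReal_natCast,
      ← ENNReal.ofReal_mul (Real.exp_pos _).le]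
    refine ENNReal.ofReal_le_ofReal ?_
    convert h

theorem Sparse.expect_card_vote_le {G : SimpleGraph V} {d : ℕ}
    (hreg : ∀ v, #(nbr G v) = d) (hd : 2 ≤ d) (hG : Sparse d G) (m : Sampling) {M : ℝ}
    (hM : 10000 * M ≤ Fintype.card V) (B : Finset V) :
    pmfExpect (roundLaw m G) (fun ω => (#(vote B ω) : ℝ≥0∞)) ≤
      ENNReal.ofReal (10 / 11) * #B +
        Fintype.card V * ind (fun A : Finset V => M < #A) B := by
  by_cases hB : M < #B
  · refine (pmfExpect_mono _ fun ω => Nat.cast_le.2 (card_le_univ _)).trans ?_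
    rw [pmfExpect_const]
    simp [ind, hB]
  · rw [not_lt] at hB
    refine le_trans ?_ le_self_add
    refine pmfExpect_uniformOfFinset_le _ ?_
    have h10 : 10000 * #B ≤ Fintype.card V := by
      have : 10000 * (#B : ℝ) ≤ Fintype.card V := by linarith
      exact_mod_cast this
    have h := hG.sum_card_vote_le hreg hd m h10
    have h' := ENNReal.ofReal_le_ofReal h
    rw [ENNReal.ofReal_mul (by positivity), ENNReal.ofReal_mul (by positivity),
      ENNReal.ofReal_sum_of_nonneg fun _ _ => Nat.cast_nonneg _] at h'
    simpa only [ENNReal.ofReal_natCast] using h'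

/-- With `card_move`, this removes the adversary from the recursions: they involve only the size. -/
theorem ind_move {V : Type*} (adv : Adversary V) (M : ℝ) (past : List (Finset V)) (B : Finset V) :
    ind (fun A : Finset V => M < #A) (adv.move past B) = ind (fun A : Finset V => M < #A) B := by
  simp [ind, adv.card_move]

theorem Sparse.expect_votingHistory_ind_le {G : SimpleGraph V} {d : ℕ}
    (hreg : ∀ v, #(nbr G v) = d) (hd : 2 ≤ d) (hG : Sparse d G) (m : Sampling) {M : ℝ}
    (hM : 10000 * M ≤ Fintype.card V) (adv : Adversary V) {B₀ : Finset V} (hB₀ : (#B₀ : ℝ) ≤ M)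
    (t : ℕ) :
    pmfExpect (votingHistory m G adv B₀ t) (fun s => ind (fun A : Finset V => M < #A) s.1) ≤
      t * ENNReal.ofReal (Real.exp (-(M / 500))) := by
  induction t with
  | zero =>
    rw [votingHistory, pmfExpect_pure]
    simp [ind, hB₀]
  | succ t ih =>
    rw [expect_votingHistory_succ]
    refine (pmfExpect_mono _ fun s => hG.expect_ind_le hreg hd m hM _).trans ?_
    simp only [ind_move]
    rw [pmfExpect_add, pmfExpect_const]
    push_cast
    rw [add_mul, one_mul]
    gcongr

/-- The recursion is `E (t+1) ≤ 10/11 * E t + n * P(size > M at time t)`, where the probability is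
at most `t * exp (-M/500)`. Summing the errors gives a quadratic in `t`, generously bounded by `t ^
2`. -/
theorem Sparse.expect_votingHistory_card_le {G : SimpleGraph V} {d : ℕ}
    (hreg : ∀ v, #(nbr G v) = d) (hd : 2 ≤ d) (hG : Sparse d G) (m : Sampling) {M : ℝ}
    (hM : 10000 * M ≤ Fintype.card V) (adv : Adversary V) {B₀ : Finset V} (hB₀ : (#B₀ : ℝ) ≤ M)
    (t : ℕ) :
    pmfExpect (votingHistory m G adv B₀ t) (fun s => (#s.1 : ℝ≥0∞)) ≤
      ENNReal.ofReal ((10 / 11) ^ t * Fintype.card V +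
        Fintype.card V * t ^ 2 * Real.exp (-(M / 500))) := by
  induction t with
  | zero =>
    rw [votingHistory, pmfExpect_pure]
    simpa using card_le_univ B₀
  | succ t ih =>
    rw [expect_votingHistory_succ m G adv B₀ t fun A => (#A : ℝ≥0∞)]
    refine (pmfExpect_mono _ fun s => hG.expect_card_vote_le hreg hd m hM _).trans ?_
    simp only [ind_move, adv.card_move]
    rw [pmfExpect_add, pmfExpect_const_mul, pmfExpect_const_mul]
    refine (add_le_add (mul_le_mul_right ih _) (mul_le_mul_right
      (hG.expect_votingHistory_ind_le hreg hd m hM adv hB₀ t) _)).trans ?_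
    rw [← ENNReal.ofReal_natCast, ← ENNReal.ofReal_natCast, ← ENNReal.ofReal_mul (by positivity),
      ← ENNReal.ofReal_mul (by positivity), ← ENNReal.ofReal_mul (by positivity),
      ← ENNReal.ofReal_add (by positivity) (by positivity)]
    refine ENNReal.ofReal_le_ofReal ?_
    push_cast
    have h1 : 0 ≤ (Fintype.card V : ℝ) * Real.exp (-(M / 500)) := by positivity
    have h2 : (0 : ℝ) ≤ t := by positivity
    rw [pow_succ (10 / 11 : ℝ)]
    nlinarith [mul_nonneg h1 h2, mul_nonneg (mul_nonneg h1 h2) h2]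

/-- On a sparse regular graph, all vertices soon hold the opinion `A`. -/
theorem Sparse.expect_votersB_le {G : SimpleGraph V} {d : ℕ}
    (hreg : ∀ v, #(nbr G v) = d) (hd : 2 ≤ d) (hG : Sparse d G) (m : Sampling) {M : ℝ}
    (hM : 10000 * M ≤ Fintype.card V) (adv : Adversary V) {B₀ : Finset V} (hB₀ : (#B₀ : ℝ) ≤ M)
    (t : ℕ) :
    pmfExpect (votersB m G adv B₀ t) (ind (· ≠ ∅)) ≤
      ENNReal.ofReal ((10 / 11) ^ t * Fintype.card V +
        Fintype.card V * t ^ 2 * Real.exp (-(M / 500))) := by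
  refine le_trans ?_ (hG.expect_votingHistory_card_le hreg hd m hM adv hB₀ t)
  rw [votersB, pmfExpect_map]
  refine pmfExpect_mono _ fun s => ?_
  -- Markov's inequality: a nonempty set has size at least 1.
  simp only [Function.comp_apply, ind]
  split_ifs with h
  · exact_mod_cast card_pos.2 (nonempty_iff_ne_empty.2 h)
  · exact zero_le

theorem card_nbr_of_isRegularOfDegree {V : Type*} [Fintype V] {G : SimpleGraph V}
    {d : ℕ} [G.LocallyFinite]
    (hG : G.IsRegularOfDegree d) (v : V) : #(nbr G v) = d := by
  rw [← hG v, ← SimpleGraph.card_neighborFinset_eq_degree]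
  congr 1
  ext w
  simp

theorem expect_randomRegularGraph_not_sparse_le {n d : ℕ} [Nonempty (RegularGraph n d)]
    (hd : 10 < d) (hn : 100 ≤ n) :
    pmfExpect (randomRegularGraph n d) (fun G => ind (fun H => ¬ Sparse d H) G.1) ≤
      ENNReal.ofReal (2500 / n) := by
  classical
  let : Fintype (RegularGraph n d) := Fintype.ofFinite _
  have hmap : (univ : Finset (RegularGraph n d)).map (Function.Embedding.subtype _) =
      regularContaining d ∅ := by
    ext G
    simp only [mem_map, mem_univ, true_and, Function.Embedding.coe_subtype, mem_regularContaining,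
      notMem_empty, false_imp_iff, implies_true, and_true]
    constructor
    · rintro ⟨H, rfl⟩
      exact card_nbr_of_isRegularOfDegree H.2
    · intro h
      refine ⟨⟨G, fun v => ?_⟩, rfl⟩
      rw [← h v, ← SimpleGraph.card_neighborFinset_eq_degree]
      congr 1
      ext w
      simp
  have hcard : #(univ : Finset (RegularGraph n d)) = #(regularContaining (V := Fin n) d ∅) := by
    rw [← hmap, card_map]
  refine pmfExpect_uniformOfFinset_le univ_nonempty ?_
  have h := card_not_sparse_le (V := Fin n) hd (by simpa using hn)
  rw [Fintype.card_fin] at h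
  calc ∑ G : RegularGraph n d, ind (fun H => ¬ Sparse d H) G.1
      = ∑ G ∈ regularContaining d ∅, ind (fun H : SimpleGraph (Fin n) => ¬ Sparse d H) G := by
        rw [← hmap, sum_map]; rfl
    _ ≤ _ := by
        rw [sum_ind, ← ENNReal.ofReal_natCast, ← ENNReal.ofReal_natCast,
          ← ENNReal.ofReal_mul (by positivity), hcard]
        refine ENNReal.ofReal_le_ofReal ?_
        convert h

/-- Since `10/11 ≤ exp (-1/11)`, taking `22 log n` steps gains `n ^ (-2)`: one factor cancels `n`,
the other is the failure probability. The floor costs at most a factor `e < 3`. -/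
theorem pow_floor_log_le {n : ℕ} (hn : 1 ≤ n) :
    (10 / 11 : ℝ) ^ ⌊22 * Real.log n⌋₊ * n ≤ 3 / n := by
  have hn' : (0 : ℝ) < n := by exact_mod_cast hn
  have h1 : (10 / 11 : ℝ) ≤ Real.exp (-(1 / 11)) := by
    linarith [Real.add_one_le_exp (-(1 / 11) : ℝ)]
  have h2 := (Nat.lt_floor_add_one (22 * Real.log n)).le
  calc (10 / 11 : ℝ) ^ ⌊22 * Real.log n⌋₊ * n
      ≤ Real.exp (-(1 / 11)) ^ ⌊22 * Real.log n⌋₊ * n := by gcongr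
    _ = Real.exp (⌊22 * Real.log n⌋₊ * (-(1 / 11))) * n := by rw [Real.exp_nat_mul]
    _ ≤ Real.exp (1 - Real.log n - Real.log n) * n := by gcongr; linarith
    _ = Real.exp 1 / n := by
        rw [Real.exp_sub, Real.exp_sub, Real.exp_log hn']
        field_simp
    _ ≤ 3 / n := by gcongr; exact Real.exp_one_lt_three.le

theorem mul_sq_floor_log_mul_exp_le {n : ℕ} (hn : 1 ≤ n) {κ : ℝ} (hκ : 0 < κ) :
    (n : ℝ) * (⌊22 * Real.log n⌋₊ : ℝ) ^ 2 * Real.exp (-(κ * n)) ≤ 11616 / κ ^ 4 / n := by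
  have hn' : (0 : ℝ) < n := by exact_mod_cast hn
  have hlog : 0 ≤ Real.log n := Real.log_natCast_nonneg n
  have h1 : (⌊22 * Real.log n⌋₊ : ℝ) ≤ 22 * n :=
    (Nat.floor_le (by positivity)).trans (by linarith [Real.log_le_sub_one_of_pos hn'])
  have h2 := Real.pow_div_factorial_le_exp (κ * n) (by positivity) 4
  -- The fourth power beats `n * (22 * n) ^ 2` with one `n` to spare; `11616 = 22 ^ 2 * 24`.
  have h3 : Real.exp (-(κ * n)) ≤ 24 / (κ * n) ^ 4 := by
    rw [Real.exp_neg, ← one_div, div_le_div_iff₀ (Real.exp_pos _) (by positivity)]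
    rw [div_le_iff₀ (by positivity)] at h2
    norm_num [Nat.factorial] at h2
    linarith
  calc _ ≤ (n : ℝ) * (22 * n) ^ 2 * (24 / (κ * n) ^ 4) := by gcongr
    _ = _ := by field_simp; norm_num

end Voting

end TwoSampleVoting

/-! ### The theorem -/

open TwoSampleVoting in
theorem mainTheorem3 :
    ∃ c : ℝ, 0 < c ∧ ∃ C : ℝ, 0 < C ∧
      ∀ δ : ℝ, 0 < δ → ∃ N : ℕ, ∀ n : ℕ, N ≤ n → ∀ d : ℕ, 10 < d →
        ∀ [Nonempty (RegularGraph n d)] (m : Sampling)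
          (B₀ : RegularGraph n d → Finset (Fin n))
          (adv : RegularGraph n d → Adversary (Fin n)),
          (∀ G, ((B₀ G).card : ℝ) ≤ c * n) →
          1 - δ ≤ (((randomRegularGraph n d).bind fun G =>
            votersB m G.1 (adv G) (B₀ G) ⌊C * Real.log n⌋₊) ∅).toReal := by
  classical
  refine ⟨1 / 10000, by norm_num, 22, by norm_num, fun δ hδ => ?_⟩
  -- `κ * n` is the Chernoff exponent `M / 500` at `M = n / 10000`. The constant `K` collects the
  -- failure of sparsity (2500), the geometric decay (3) and the escape above `M`, each divided by
  -- `n`.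
  set κ : ℝ := 1 / 5000000 with hκ
  set K : ℝ := 2500 + (3 + 11616 / κ ^ 4) with hK
  obtain ⟨N, hN⟩ := exists_nat_ge (K / δ)
  refine ⟨max N 100, fun n hn d hd _ m B₀ adv hB₀ => ?_⟩
  have hn100 : 100 ≤ n := (le_max_right _ _).trans hn
  have hn0 : (0 : ℝ) < n := by exact_mod_cast (by omega : 0 < n)
  have hKδ : K / n ≤ δ := by
    rw [div_le_iff₀ hn0, mul_comm, ← div_le_iff₀ hδ]
    exact hN.trans (by exact_mod_cast (le_max_left _ _).trans hn)
  refine one_sub_le_toReal_apply _ _ hδ.le ?_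
  rw [pmfExpect_bind]
  set ε : ℝ := (3 + 11616 / κ ^ 4) / n with hε
  have hG : ∀ G : RegularGraph n d,
      pmfExpect (votersB m G.1 (adv G) (B₀ G) ⌊22 * Real.log n⌋₊) (ind (· ≠ ∅)) ≤
        ind (fun H => ¬ Sparse d H) G.1 + ENNReal.ofReal ε := by
    intro G
    by_cases hS : Sparse d G.1
    · refine le_trans ?_ le_add_self
      refine (hS.expect_votersB_le (card_nbr_of_isRegularOfDegree G.2) (by omega) m
        (M := 1 / 10000 * n) (by rw [Fintype.card_fin]; linarith) (adv G) (hB₀ G) _).trans ?_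
      refine ENNReal.ofReal_le_ofReal ?_
      rw [Fintype.card_fin, hε, add_div]
      refine add_le_add (pow_floor_log_le (by omega)) ?_
      have hexp : 1 / 10000 * (n : ℝ) / 500 = κ * n := by rw [hκ]; ring
      rw [hexp]
      exact mul_sq_floor_log_mul_exp_le (by omega) (by positivity)
    · refine (pmfExpect_mono _ fun ω => ind_le_one _ _).trans ?_
      rw [pmfExpect_const]
      simp [ind, hS]
  refine (pmfExpect_mono _ hG).trans ?_
  rw [pmfExpect_add, pmfExpect_const]
  refine (add_le_add_left (expect_randomRegularGraph_not_sparse_le hd hn100) _).trans ?_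
  rw [← ENNReal.ofReal_add (by positivity) (by positivity)]
  refine ENNReal.ofReal_le_ofReal (le_trans (le_of_eq ?_) hKδ)
  rw [hε, hK]; ring
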